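/- **Setting.** Let $\lambda>0$, $\tau\in(0,1)$, $L_0>0$, $0<\varepsilon\le 1/4$, $k^*>3/(2\varepsilon)$ and $M\in\mathbb R$. Let $(d_n)$ be a sequence of natural numbers with $d_n=o(n^{1/4-\varepsilon})$ as $n\to\infty$. For given $n,p$ with $\tau\le p/n\le 1/\tau$ consider the following. * $\ell_0:\mathbb R\to\mathbb R$ is convex and has a weak derivative $\ell_0'$, with $\max\{\ell_0(0),\operatorname{ess\,sup}|\ell_0'|\}\le L_0$ (e.g. the absolute or the Huber loss); $\theta_0\in\mathbb R^p$; $\Sigma\in\mathbb R^{p\times p}$ is positive definite. * $X_1,\dots,X_n$ are i.i.d. random vectors in $\mathbb R^p$ with $E[X_i]=0$, $E[X_iX_i^\top]=\Sigma/n$ and $\max_{j\le p}E|\sqrt n\,X_{i,j}|^{2\lceil k^*/2\rceil}\le M$. They are $d_n$-block dependent: there is a partition of $\{1,\dots,p\}$ into at most $p$ cells of size at most $d_n$ such that coordinates of $X_i$ with indices in different cells are independent. * $G_1,\dots,G_n$ are i.i.d. $N(0,\Sigma/n)$, and the noise variables $\xi_1,\dots,\xi_n$ are i.i.d., independent of $(X_i)_i$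 and independent of $(G_i)_i$. * For a design $\mathbf Z=(Z_1,\dots,Z_n)^\top$ put $$H^R(w,\mathbf Z,\xi)=\frac1n\sum_{i=1}^n\ell_0(Z_i^\top w-\xi_i)+\frac{\lambda}{2}\|w+\theta_0\|^2,\qquad w\in\mathbb R^p,$$ with the Euclidean norm, and let $\hat w^R_{\mathbf X}$ be the minimizer of $H^R(\cdot,\mathbf X,\xi)$ over $\mathbb R^p$. **Theorem.** There is a constant $K>0$, depending only on $\lambda,\tau,M,k^*,\varepsilon,L_0$, such that for every such sequence $(d_n)$ and all sufficiently large $n$ (how large depends only on the same parameters and on the sequence $(d_n)$) the following holds for all $p$, $\ell_0$, $\theta_0$, $\Sigma$, $X$, $G$, $\xi$ as above. Let $\mathcal S_n\subset\mathbb R^p$ be measurable, and suppose that $z\in\mathbb R$, $\rho_0>0$ and $\varepsilon_n\in[0,1/4)$ satisfy the gap condition $$\max\Big\{\Pr\big(\min_{w\in\mathbb R^p}H^R(w,\mathbf G,\xi)\ge z+\rho_0\big),\ \Pr\big(\min_{w\in\mathcal S_n}H^R(w,\mathbf G,\xi)\le z+2\rho_0\big)\Big\}\le\varepsilon_n ,$$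 where the minimum over $\mathcal S_n$ is read as an infimum ($+\infty$ if $\mathcal S_n=\emptyset$). Then $$\Pr(\hat w^R_{\mathbf X}\in\mathcal S_n)\le 4\varepsilon_n+K\big(1+\|\theta_0\|_\infty^{k^*}+\rho_0^{-3}\big)\,n^{-1/45}.$$ -/

import Mathlib

open MeasureTheory ProbabilityTheory Filter Asymptotics


/-- `g` is a weak derivative of `f : ℝ → ℝ`: both are locally integrable and integration by parts
holds against every smooth compactly supported test function. -/
def IsWeakDeriv (f g : ℝ → ℝ) : Prop :=
  LocallyIntegrable f volume ∧ LocallyIntegrable g volume ∧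
    ∀ φ : ℝ → ℝ, ContDiff ℝ ((⊤ : ℕ∞) : WithTop ℕ∞) φ → HasCompactSupport φ →
      ∫ x, f x * deriv φ x = -∫ x, g x * φ x

/-- A robust loss with constant `L₀`: a convex function on the real line, with value at most `L₀`
at the origin, that has a weak derivative bounded by `L₀` almost everywhere. -/
def IsRobustLoss (loss : ℝ → ℝ) (L₀ : ℝ) : Prop :=
  ConvexOn ℝ Set.univ loss ∧ loss 0 ≤ L₀ ∧
    ∃ g : ℝ → ℝ, IsWeakDeriv loss g ∧ ∀ᵐ x ∂(volume : Measure ℝ), |g x| ≤ L₀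

/-- The robust cost
`n⁻¹ ∑ i, loss (xᵢᵀ w - ξᵢ) + (lam / 2) ‖w + θ₀‖²`, where `x i` is the `i`-th row of the design
matrix and `ξ` is the noise vector. The norm is the Euclidean one. -/
noncomputable def robustCost {n p : ℕ} (loss : ℝ → ℝ) (lam : ℝ)
    (θ₀ : EuclideanSpace ℝ (Fin p)) (x : Fin n → EuclideanSpace ℝ (Fin p)) (ξ : Fin n → ℝ)
    (w : EuclideanSpace ℝ (Fin p)) : ℝ :=
  (1 / (n : ℝ)) * ∑ i, loss (inner ℝ (x i) w - ξ i) + lam / 2 * ‖w + θ₀‖ ^ 2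

/-- The minimal value (infimum) over `S` of the robust cost, as an extended real number
(`+∞` if `S` is empty). -/
noncomputable def minRobustCost {n p : ℕ} (loss : ℝ → ℝ) (lam : ℝ)
    (θ₀ : EuclideanSpace ℝ (Fin p)) (S : Set (EuclideanSpace ℝ (Fin p)))
    (x : Fin n → EuclideanSpace ℝ (Fin p)) (ξ : Fin n → ℝ) : EReal :=
  ⨅ w ∈ S, ((robustCost loss lam θ₀ x ξ w : ℝ) : EReal)

/-- `Z 0, Z 1, …` are independent and identically distributed random variables under `P`. -/
def IsIID {Ω E : Type*} [MeasurableSpace Ω] [MeasurableSpace E] {n : ℕ} (Z : Fin n → Ω → E)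
    (P : Measure Ω) : Prop :=
  (∀ i, Measurable (Z i)) ∧ iIndepFun Z P ∧ ∀ i j, IdentDistrib (Z i) (Z j) P P

/-- Block dependence of a random vector with parameter `d`: the coordinates are partitioned into
at most `p` cells of cardinality at most `d`, and two coordinates from different cells are
independent. -/
def IsBlockDependent {Ω : Type*} [MeasurableSpace Ω] {p : ℕ}
    (X : Ω → EuclideanSpace ℝ (Fin p)) (d : ℕ) (P : Measure Ω) : Prop :=
  ∃ k : ℕ, k ≤ p ∧ ∃ B : Fin k → Finset (Fin p),
    (∀ a b, a ≠ b → Disjoint (B a) (B b)) ∧ (∀ l, ∃ a, l ∈ B a) ∧ (∀ a, (B a).card ≤ d) ∧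
    ∀ a b, a ≠ b → ∀ l ∈ B a, ∀ m ∈ B b, IndepFun (fun ω => X ω l) (fun ω => X ω m) P

/-- `X` has mean zero and second moment matrix `Sig / n`. -/
def HasMoments {Ω : Type*} [MeasurableSpace Ω] {p : ℕ} (X : Ω → EuclideanSpace ℝ (Fin p))
    (n : ℕ) (Sig : Matrix (Fin p) (Fin p) ℝ) (P : Measure Ω) : Prop :=
  (∀ j, Integrable (fun ω => X ω j) P ∧ ∫ ω, X ω j ∂P = 0) ∧
    ∀ j l, Integrable (fun ω => X ω j * X ω l) P ∧ ∫ ω, X ω j * X ω l ∂P = Sig j l / n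

/-! No comparison between the two designs is needed: at this scaling the data term is almost flat,
for either design. The squared Frobenius norm of the Gram matrix has expectation of order `n d`,
since distinct rows contribute `‖Σ/n‖_F²` each, block dependence makes `Σ` sparse, and fourth
moments control the diagonal (`integral_gramSq_le_of_proportional`). By Markov, the operator norm of
the Gram matrix is at most `n κ²` with high probability, and then the data term is `L₀ κ`-Lipschitz
in `w` (`abs_robustCost_sub_le`).

On that event the penalty forces every minimizer into the ball of radius `2 L₀ κ / lam` about `-θ₀`,
and throughout this ball the cost is within `5 (L₀ κ)² / lam` of its infimum. Choose `κ` so that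
this equals `ρ₀`. One good outcome of the Gaussian problem then shows that the deterministic set `S`
misses the ball, so `ŵ ∈ S` requires a badly conditioned `X`. Markov bounds this by a multiple of
`ρ₀⁻² d / n`, well below the claimed rate. -/

/-! ### Robust losses are Lipschitz. -/

theorem ConvexOn.absolutelyContinuousOnInterval {f : ℝ → ℝ} (hf : ConvexOn ℝ Set.univ f)
    (a b : ℝ) : AbsolutelyContinuousOnInterval f a b := by
  have h : LocallyLipschitzOn (Set.uIcc a b) f :=
    (hf.locallyLipschitzOn isOpen_univ).mono (Set.subset_univ _)
  obtain ⟨K, hK⟩ := h.exists_lipschitzOnWith_of_compact isCompact_uIcc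
  exact hK.absolutelyContinuousOnInterval

theorem ConvexOn.locallyIntegrable_deriv {f : ℝ → ℝ} (hf : ConvexOn ℝ Set.univ f) :
    LocallyIntegrable (deriv f) volume := by
  rw [locallyIntegrable_iff]
  intro k hk
  obtain ⟨R, hR⟩ := hk.isBounded.subset_closedBall 0
  -- The left end is moved by one because `Ioc` omits it.
  have h := (hf.absolutelyContinuousOnInterval (-R - 1) R).intervalIntegrable_deriv
  refine IntegrableOn.mono_set (h.1.mono_set (t := Set.Ioc (-R - 1) R) le_rfl) fun x hx => ?_
  have hx' := hR hx
  rw [Metric.mem_closedBall, Real.dist_eq, sub_zero, abs_le] at hx'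
  exact ⟨by linarith, hx'.2⟩

theorem ConvexOn.integral_mul_deriv_eq_neg {f φ : ℝ → ℝ} (hf : ConvexOn ℝ Set.univ f)
    (hφ : ContDiff ℝ 1 φ) (hc : HasCompactSupport φ) :
    ∫ x, f x * deriv φ x = -∫ x, deriv f x * φ x := by
  obtain ⟨R, hR⟩ := hc.isCompact.isBounded.subset_closedBall 0
  have hsupp : tsupport φ ⊆ Set.Ioc (-(|R| + 1)) (|R| + 1) := fun x hx => by
    have hx' := hR hx
    rw [Metric.mem_closedBall, Real.dist_eq, sub_zero, abs_le] at hx'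
    have := le_abs_self R
    exact ⟨by linarith, by linarith⟩
  have hzero : ∀ x, x ∉ Set.Ioo (-(|R| + 1)) (|R| + 1) → φ x = 0 := fun x hx => by
    by_contra h
    have hx' := hR (subset_tsupport φ (Function.mem_support.2 h))
    rw [Metric.mem_closedBall, Real.dist_eq, sub_zero, abs_le] at hx'
    have := le_abs_self R
    exact hx ⟨by linarith, by linarith⟩
  have hle : -(|R| + 1) ≤ |R| + 1 := by linarith [abs_nonneg R]
  have key := (hf.absolutelyContinuousOnInterval (-(|R| + 1)) (|R| + 1)
    ).integral_mul_deriv_eq_deriv_mul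
    (hφ.contDiffOn.absolutelyContinuousOnInterval (a := -(|R| + 1)) (b := |R| + 1))
  rw [hzero _ (fun h => lt_irrefl _ h.1), hzero (|R| + 1) (fun h => lt_irrefl _ h.2),
    intervalIntegral.integral_of_le hle, intervalIntegral.integral_of_le hle,
    setIntegral_eq_integral_of_forall_compl_eq_zero,
    setIntegral_eq_integral_of_forall_compl_eq_zero] at key
  · simpa using key
  · intro x hx
    rw [hzero x fun h => hx ⟨h.1, h.2.le⟩, mul_zero]
  · intro x hx
    rw [image_eq_zero_of_notMem_tsupport fun h => hx (hsupp (tsupport_deriv_subset h)), mul_zero]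

/-- A convex function is locally absolutely continuous, so its classical derivative is also a weak
one. Weak derivatives are a.e. unique, so the bound on `g` passes to `deriv loss` and can be
integrated. -/
theorem IsRobustLoss.abs_sub_le {loss : ℝ → ℝ} {L₀ : ℝ} (h : IsRobustLoss loss L₀) (a b : ℝ) :
    |loss a - loss b| ≤ L₀ * |a - b| := by
  obtain ⟨hconv, -, g, ⟨-, hg, hparts⟩, hbound⟩ := h
  have hae : ∀ᵐ x, deriv loss x = g x := by
    refine ae_eq_of_integral_contDiff_smul_eq hconv.locallyIntegrable_deriv hg fun φ hφ hc => ?_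
    have h₁ := hconv.integral_mul_deriv_eq_neg (hφ.of_le (by exact_mod_cast le_top)) hc
    rw [hparts φ hφ hc, neg_inj] at h₁
    simp only [smul_eq_mul, mul_comm (φ _)]
    exact h₁.symm
  rw [← (hconv.absolutelyContinuousOnInterval b a).integral_deriv_eq_sub, ← Real.norm_eq_abs]
  refine intervalIntegral.norm_integral_le_of_norm_le_const_ae ?_
  filter_upwards [hae, hbound] with x h₁ h₂ _
  rwa [h₁]

/-! ### Deterministic bounds through the Gram matrix. -/

/-- The squared Frobenius norm of the Gram matrix of the rows of a design. -/
noncomputable def gramSq {n p : ℕ} (x : Fin n → EuclideanSpace ℝ (Fin p)) : ℝ :=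
  ∑ i, ∑ j, (inner ℝ (x i) (x j)) ^ 2

theorem gramSq_nonneg {n p : ℕ} (x : Fin n → EuclideanSpace ℝ (Fin p)) : 0 ≤ gramSq x := by
  unfold gramSq; positivity

/-- Cauchy–Schwarz over pairs of indices, after expanding the square: the operator norm of the Gram
matrix is at most its Frobenius norm. -/
theorem sq_norm_sum_smul_le {n p : ℕ} (x : Fin n → EuclideanSpace ℝ (Fin p)) (a : Fin n → ℝ) :
    (‖∑ i, a i • x i‖ ^ 2) ^ 2 ≤ (∑ i, a i ^ 2) ^ 2 * gramSq x := by
  have h : ‖∑ i, a i • x i‖ ^ 2 =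
      ∑ q : Fin n × Fin n, (a q.1 * a q.2) * inner ℝ (x q.1) (x q.2) := by
    rw [← real_inner_self_eq_norm_sq, sum_inner, Fintype.sum_prod_type]
    refine Finset.sum_congr rfl fun i _ => ?_
    rw [inner_sum]
    refine Finset.sum_congr rfl fun j _ => ?_
    rw [real_inner_smul_left, real_inner_smul_right, mul_assoc]
  have h' : (∑ i, a i ^ 2) ^ 2 = ∑ q : Fin n × Fin n, (a q.1 * a q.2) ^ 2 := by
    rw [sq, Finset.sum_mul_sum, Fintype.sum_prod_type]
    simp only [mul_pow]
  have h'' : gramSq x = ∑ q : Fin n × Fin n, (inner ℝ (x q.1) (x q.2)) ^ 2 := by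
    rw [gramSq, Fintype.sum_prod_type]
  rw [h, h', h'']
  exact Finset.sum_mul_sq_le_sq_mul_sq _ _ _

/-- Duality: with `a i = ⟪x i, w⟫`, the left side `s` is `⟪∑ a i • x i, w⟫`. Cauchy–Schwarz and the
previous bound give `s² ≤ s q ‖w‖²`, and `s` cancels. -/
theorem sum_sq_inner_le {n p : ℕ} {x : Fin n → EuclideanSpace ℝ (Fin p)} {q : ℝ} (hq : 0 ≤ q)
    (h : gramSq x ≤ q ^ 2) (w : EuclideanSpace ℝ (Fin p)) :
    ∑ i, (inner ℝ (x i) w) ^ 2 ≤ q * ‖w‖ ^ 2 := by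
  set a : Fin n → ℝ := fun i => inner ℝ (x i) w with ha
  set s := ∑ i, a i ^ 2 with hs
  have hs0 : 0 ≤ s := by positivity
  have h1 : s = inner ℝ (∑ i, a i • x i) w := by
    simp [sum_inner, real_inner_smul_left, hs, ha, sq]
  have h2 : s ≤ ‖∑ i, a i • x i‖ * ‖w‖ := h1 ▸ real_inner_le_norm _ _
  have h3 : ‖∑ i, a i • x i‖ ^ 2 ≤ s * q := by
    refine le_of_sq_le_sq ?_ (by positivity)
    calc _ ≤ s ^ 2 * gramSq x := sq_norm_sum_smul_le x a
      _ ≤ s ^ 2 * q ^ 2 := by gcongr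
      _ = _ := by ring
  have h4 : s ^ 2 ≤ s * (q * ‖w‖ ^ 2) :=
    calc s ^ 2 ≤ (‖∑ i, a i • x i‖ * ‖w‖) ^ 2 := by gcongr
      _ = ‖∑ i, a i • x i‖ ^ 2 * ‖w‖ ^ 2 := by ring
      _ ≤ s * q * ‖w‖ ^ 2 := by gcongr
      _ = _ := by ring
  rcases hs0.eq_or_lt with h0 | h0
  · rw [← h0]; positivity
  · rw [sq] at h4
    exact le_of_mul_le_mul_left h4 h0

theorem mean_abs_inner_le {n p : ℕ} {x : Fin n → EuclideanSpace ℝ (Fin p)} {κ : ℝ} (hκ : 0 ≤ κ)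
    (h : gramSq x ≤ (n * κ ^ 2) ^ 2) (w : EuclideanSpace ℝ (Fin p)) :
    (1 / (n : ℝ)) * ∑ i, |inner ℝ (x i) w| ≤ κ * ‖w‖ := by
  rcases Nat.eq_zero_or_pos n with rfl | hn
  · simp; positivity
  have hn' : (0 : ℝ) < n := by exact_mod_cast hn
  rw [one_div, inv_mul_le_iff₀ hn']
  refine le_of_sq_le_sq ?_ (by positivity)
  have h1 := sq_sum_le_card_mul_sum_sq (s := Finset.univ) (f := fun i => |inner ℝ (x i) w|)
  simp only [sq_abs, Finset.card_univ, Fintype.card_fin] at h1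
  calc _ ≤ n * ∑ i, (inner ℝ (x i) w) ^ 2 := h1
    _ ≤ n * (n * κ ^ 2 * ‖w‖ ^ 2) := by gcongr; exact sum_sq_inner_le (by positivity) h w
    _ = _ := by ring

/-! ### Localization of minimizers near `-θ₀`. -/

section Cost

variable {n p : ℕ} {loss : ℝ → ℝ} {L₀ lam κ : ℝ} {θ₀ : EuclideanSpace ℝ (Fin p)}
  {x : Fin n → EuclideanSpace ℝ (Fin p)} {ξ : Fin n → ℝ}

/-- Up to the penalty, the cost is Lipschitz with constant `L₀ κ`. -/
theorem abs_robustCost_sub_le (hloss : ∀ a b, |loss a - loss b| ≤ L₀ * |a - b|) (hL : 0 ≤ L₀)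
    (hκ : 0 ≤ κ) (h : gramSq x ≤ (n * κ ^ 2) ^ 2) (w : EuclideanSpace ℝ (Fin p)) :
    |robustCost loss lam θ₀ x ξ w - lam / 2 * ‖w + θ₀‖ ^ 2 - robustCost loss lam θ₀ x ξ (-θ₀)| ≤
      L₀ * κ * ‖w + θ₀‖ := by
  have h1 : robustCost loss lam θ₀ x ξ w - lam / 2 * ‖w + θ₀‖ ^ 2 -
      robustCost loss lam θ₀ x ξ (-θ₀) = (1 / (n : ℝ)) *
        ∑ i, (loss (inner ℝ (x i) w - ξ i) - loss (inner ℝ (x i) (-θ₀) - ξ i)) := by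
    rw [robustCost, robustCost, Finset.sum_sub_distrib]
    simp; ring
  rw [h1, abs_mul, abs_of_nonneg (by positivity)]
  calc _ ≤ (1 / (n : ℝ)) * ∑ i, L₀ * |inner ℝ (x i) (w + θ₀)| := by
        gcongr
        refine (Finset.abs_sum_le_sum_abs _ _).trans (Finset.sum_le_sum fun i _ => ?_)
        refine (hloss _ _).trans_eq ?_
        rw [inner_add_right, inner_neg_right]
        congr 2; ring
    _ = L₀ * ((1 / (n : ℝ)) * ∑ i, |inner ℝ (x i) (w + θ₀)|) := by
        rw [← Finset.mul_sum]; ring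
    _ ≤ L₀ * (κ * ‖w + θ₀‖) := mul_le_mul_of_nonneg_left (mean_abs_inner_le hκ h _) hL
    _ = _ := by ring

/-- The quadratic penalty must be paid for by a data term that gains at most linearly in the
distance to `-θ₀`. -/
theorem norm_add_le_of_robustCost_le (hloss : ∀ a b, |loss a - loss b| ≤ L₀ * |a - b|)
    (hL : 0 ≤ L₀) (hκ : 0 ≤ κ) (h : gramSq x ≤ (n * κ ^ 2) ^ 2)
    {w : EuclideanSpace ℝ (Fin p)}
    (hw : robustCost loss lam θ₀ x ξ w ≤ robustCost loss lam θ₀ x ξ (-θ₀)) :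
    lam * ‖w + θ₀‖ ≤ 2 * (L₀ * κ) := by
  have h1 := (abs_le.1 (abs_robustCost_sub_le (lam := lam) (θ₀ := θ₀) (ξ := ξ) hloss hL hκ h w)).1
  rcases (norm_nonneg (w + θ₀)).eq_or_lt with h0 | h0
  · rw [← h0]; simp; positivity
  · refine le_of_mul_le_mul_right (a := ‖w + θ₀‖) ?_ h0
    nlinarith

/-- Near `-θ₀` the cost almost attains its minimum. -/
theorem robustCost_sub_le (hloss : ∀ a b, |loss a - loss b| ≤ L₀ * |a - b|)
    (hL : 0 ≤ L₀) (hlam : 0 < lam) (hκ : 0 ≤ κ) (h : gramSq x ≤ (n * κ ^ 2) ^ 2)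
    {w : EuclideanSpace ℝ (Fin p)} (hw : lam * ‖w + θ₀‖ ≤ 2 * (L₀ * κ))
    (v : EuclideanSpace ℝ (Fin p)) :
    lam * (robustCost loss lam θ₀ x ξ w - robustCost loss lam θ₀ x ξ v) ≤ 5 * (L₀ * κ) ^ 2 := by
  have h1 := (abs_le.1 (abs_robustCost_sub_le (lam := lam) (θ₀ := θ₀) (ξ := ξ) hloss hL hκ h w)).2
  have h2 := (abs_le.1 (abs_robustCost_sub_le (lam := lam) (θ₀ := θ₀) (ξ := ξ) hloss hL hκ h v)).1
  have hc : 0 ≤ L₀ * κ := by positivity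
  set c := L₀ * κ
  set s := ‖w + θ₀‖
  set t := ‖v + θ₀‖
  have hs : 0 ≤ s := norm_nonneg _
  have h3 : lam * (robustCost loss lam θ₀ x ξ w - robustCost loss lam θ₀ x ξ v) ≤
      lam * (c * s + lam / 2 * s ^ 2 + c * t - lam / 2 * t ^ 2) := by
    refine mul_le_mul_of_nonneg_left ?_ hlam.le
    linarith
  have h4 : (lam * s) ^ 2 ≤ (2 * c) ^ 2 := by gcongr
  have h5 : c * (lam * s) ≤ c * (2 * c) := by gcongr
  -- The terms in `s` give at most `4 c²`; completing the square in `lam * t` gives at most `c² / 2`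
  -- more.
  nlinarith [sq_nonneg (lam * t - c)]

end Cost

/-! ### Second and fourth moments, and the expected Gram norm. -/

section Moments

variable {Ω : Type*} [MeasurableSpace Ω] {P : Measure Ω} {n p : ℕ}

theorem integral_sq_inner_of_indepFun {Y Z : Ω → EuclideanSpace ℝ (Fin p)}
    {T : Matrix (Fin p) (Fin p) ℝ} (hYZ : IndepFun Y Z P)
    (hTY : ∀ j l, Integrable (fun ω => Y ω j * Y ω l) P ∧ ∫ ω, Y ω j * Y ω l ∂P = T j l)
    (hTZ : ∀ j l, Integrable (fun ω => Z ω j * Z ω l) P ∧ ∫ ω, Z ω j * Z ω l ∂P = T j l) :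
    Integrable (fun ω => inner ℝ (Y ω) (Z ω) ^ 2) P ∧
      ∫ ω, inner ℝ (Y ω) (Z ω) ^ 2 ∂P = ∑ j, ∑ l, T j l ^ 2 := by
  have hexp : (fun ω => inner ℝ (Y ω) (Z ω) ^ 2) =
      fun ω => ∑ j, ∑ l, (Y ω j * Y ω l) * (Z ω j * Z ω l) := by
    funext ω
    rw [PiLp.inner_apply, sq, Finset.sum_mul_sum]
    refine Finset.sum_congr rfl fun j _ => Finset.sum_congr rfl fun l _ => ?_
    simp only [Real.inner_apply]
    ring
  have hind : ∀ j l, IndepFun (fun ω => Y ω j * Y ω l) (fun ω => Z ω j * Z ω l) P := fun j l =>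
    hYZ.comp (φ := fun y : EuclideanSpace ℝ (Fin p) => y j * y l)
      (ψ := fun y : EuclideanSpace ℝ (Fin p) => y j * y l) (by fun_prop) (by fun_prop)
  have hint : ∀ j l, Integrable (fun ω => (Y ω j * Y ω l) * (Z ω j * Z ω l)) P := fun j l =>
    (hind j l).integrable_mul (hTY j l).1 (hTZ j l).1
  rw [hexp]
  refine ⟨integrable_finsetSum _ fun j _ => integrable_finsetSum _ fun l _ => hint j l, ?_⟩
  rw [integral_finsetSum _ fun j _ => integrable_finsetSum _ fun l _ => hint j l]
  refine Finset.sum_congr rfl fun j _ => ?_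
  rw [integral_finsetSum _ fun l _ => hint j l]
  refine Finset.sum_congr rfl fun l _ => ?_
  rw [(hind j l).integral_fun_mul_eq_mul_integral (hTY j l).1.1 (hTZ j l).1.1, (hTY j l).2,
    (hTZ j l).2, sq]

theorem integral_sq_inner_self_le {Y : Ω → EuclideanSpace ℝ (Fin p)} {c : ℝ} (hY : Measurable Y)
    (h4 : ∀ j, Integrable (fun ω => Y ω j ^ 4) P ∧ ∫ ω, Y ω j ^ 4 ∂P ≤ c) :
    Integrable (fun ω => inner ℝ (Y ω) (Y ω) ^ 2) P ∧
      ∫ ω, inner ℝ (Y ω) (Y ω) ^ 2 ∂P ≤ (p : ℝ) ^ 2 * c := by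
  have hle : ∀ ω, inner ℝ (Y ω) (Y ω) ^ 2 ≤ p * ∑ j, Y ω j ^ 4 := fun ω => by
    have h := sq_sum_le_card_mul_sum_sq (s := Finset.univ) (f := fun j => Y ω j ^ 2)
    simp only [Finset.card_univ, Fintype.card_fin, ← pow_mul] at h
    rwa [real_inner_self_eq_norm_sq, EuclideanSpace.real_norm_sq_eq]
  have hint : Integrable (fun ω => p * ∑ j, Y ω j ^ 4) P :=
    (integrable_finsetSum _ fun j _ => (h4 j).1).const_mul _
  have hint' : Integrable (fun ω => inner ℝ (Y ω) (Y ω) ^ 2) P := by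
    refine hint.mono' ((hY.inner hY).pow_const 2).aestronglyMeasurable (.of_forall fun ω => ?_)
    rw [Real.norm_of_nonneg (sq_nonneg _)]
    exact hle ω
  refine ⟨hint', (integral_mono hint' hint hle).trans ?_⟩
  rw [integral_const_mul, integral_finsetSum _ fun j _ => (h4 j).1]
  calc _ ≤ (p : ℝ) * ∑ _j : Fin p, c := by gcongr with j; exact (h4 j).2
    _ = _ := by simp; ring

/-- For distinct rows independence factorizes the expectation into `∑ T j l ^ 2`; only the `n`
diagonal terms involve fourth moments. -/
theorem integral_gramSq_le {Z : Fin n → Ω → EuclideanSpace ℝ (Fin p)}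
    {T : Matrix (Fin p) (Fin p) ℝ} {c : ℝ} (hZ : ∀ i, Measurable (Z i)) (hind : iIndepFun Z P)
    (hT : ∀ i j l, Integrable (fun ω => Z i ω j * Z i ω l) P ∧
      ∫ ω, Z i ω j * Z i ω l ∂P = T j l)
    (h4 : ∀ i j, Integrable (fun ω => Z i ω j ^ 4) P ∧ ∫ ω, Z i ω j ^ 4 ∂P ≤ c) :
    Integrable (fun ω => gramSq fun i => Z i ω) P ∧
      ∫ ω, gramSq (fun i => Z i ω) ∂P ≤
        (n : ℝ) ^ 2 * ∑ j, ∑ l, T j l ^ 2 + n * ((p : ℝ) ^ 2 * c) := by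
  have hterm : ∀ i i', Integrable (fun ω => inner ℝ (Z i ω) (Z i' ω) ^ 2) P ∧
      ∫ ω, inner ℝ (Z i ω) (Z i' ω) ^ 2 ∂P ≤
        (∑ j, ∑ l, T j l ^ 2) + if i = i' then (p : ℝ) ^ 2 * c else 0 := by
    intro i i'
    by_cases h : i = i'
    · subst h
      have h := integral_sq_inner_self_le (hZ i) (h4 i)
      rw [if_pos rfl]
      exact ⟨h.1, h.2.trans (le_add_of_nonneg_left (by positivity))⟩
    · have h' := integral_sq_inner_of_indepFun (hind.indepFun h) (hT i) (hT i')
      rw [if_neg h, add_zero]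
      exact ⟨h'.1, h'.2.le⟩
  have hint : ∀ i, Integrable (fun ω => ∑ i', inner ℝ (Z i ω) (Z i' ω) ^ 2) P := fun i =>
    integrable_finsetSum _ fun i' _ => (hterm i i').1
  unfold gramSq
  refine ⟨integrable_finsetSum _ fun i _ => hint i, ?_⟩
  rw [integral_finsetSum _ fun i _ => hint i]
  calc _ ≤ ∑ i : Fin n, ∑ i' : Fin n,
        ((∑ j, ∑ l, T j l ^ 2) + if i = i' then (p : ℝ) ^ 2 * c else 0) := by
        refine Finset.sum_le_sum fun i _ => ?_
        rw [integral_finsetSum _ fun i' _ => (hterm i i').1]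
        exact Finset.sum_le_sum fun i' _ => (hterm i i').2
    _ = _ := by simp [Finset.sum_add_distrib]; ring

theorem measureReal_gramSq_lt_le [IsProbabilityMeasure P]
    {Z : Fin n → Ω → EuclideanSpace ℝ (Fin p)} {e t : ℝ} (ht : 0 < t)
    (h : Integrable (fun ω => gramSq fun i => Z i ω) P ∧ ∫ ω, gramSq (fun i => Z i ω) ∂P ≤ e) :
    P.real {ω | t < gramSq fun i => Z i ω} ≤ e / t := by
  rw [le_div_iff₀ ht, mul_comm]
  refine le_trans ?_ ((mul_meas_ge_le_integral_of_nonneg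
    (.of_forall fun ω => gramSq_nonneg _) h.1 t).trans h.2)
  exact mul_le_mul_of_nonneg_left
    (measureReal_mono (Set.ofPred_subset_ofPred.2 fun ω hω => hω.le)) ht.le

/-- Fourth moment of the standard normal law. -/
noncomputable def gaussianFourthMoment : ℝ := ∫ x, x ^ 4 ∂(gaussianReal 0 1)

theorem gaussianFourthMoment_nonneg : 0 ≤ gaussianFourthMoment :=
  integral_nonneg fun x => by positivity

theorem integral_pow_four_gaussianReal (v : NNReal) :
    Integrable (fun x => x ^ 4) (gaussianReal 0 v) ∧
      ∫ x, x ^ 4 ∂(gaussianReal 0 v) = gaussianFourthMoment * (v : ℝ) ^ 2 := by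
  refine ⟨?_, ?_⟩
  · have h := (memLp_id_gaussianReal (μ := 0) (v := v) 4).integrable_norm_pow (by norm_num)
    simpa only [NNReal.coe_ofNat, id, Real.norm_eq_abs, Even.pow_abs (by decide : Even 4)] using h
  · have h := gaussianReal_map_const_mul (μ := 0) (v := 1) (√(v : ℝ))
    have hv : (NNReal.mk (√(v : ℝ) ^ 2) (sq_nonneg _)) * 1 = v := by
      ext; simp
    rw [mul_zero, hv] at h
    rw [← h, integral_map (by fun_prop) (by fun_prop)]
    simp only [mul_pow]
    rw [integral_const_mul, gaussianFourthMoment, mul_comm]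
    congr 1
    rw [show (4 : ℕ) = 2 * 2 from rfl, pow_mul, Real.sq_sqrt v.coe_nonneg]

variable {T : Matrix (Fin p) (Fin p) ℝ} {Y : Ω → EuclideanSpace ℝ (Fin p)}

theorem integral_pow_four_of_hasLaw_multivariateGaussian (hT : T.PosSemidef)
    (hY : HasLaw Y (multivariateGaussian 0 T) P) (j : Fin p) :
    Integrable (fun ω => Y ω j ^ 4) P ∧ ∫ ω, Y ω j ^ 4 ∂P = gaussianFourthMoment * T j j ^ 2 := by
  have h := (measurePreserving_eval_multivariateGaussian (μ := 0) hT (i := j)).fun_comp_hasLaw hY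
  simp only [PiLp.zero_apply] at h
  have h4 := integral_pow_four_gaussianReal (T j j).toNNReal
  rw [← h.map_eq] at h4
  have hm : AEStronglyMeasurable (fun x : ℝ => x ^ 4) (P.map fun ω => Y ω j) := by fun_prop
  rw [integrable_map_measure hm h.aemeasurable, integral_map h.aemeasurable hm,
    Real.coe_toNNReal _ hT.diag_nonneg] at h4
  exact h4

theorem integral_mul_of_hasLaw_multivariateGaussian (hT : T.PosSemidef)
    (hY : HasLaw Y (multivariateGaussian 0 T) P) (j l : Fin p) :
    Integrable (fun ω => Y ω j * Y ω l) P ∧ ∫ ω, Y ω j * Y ω l ∂P = T j l := by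
  have hL : ∀ i, MemLp (fun x : EuclideanSpace ℝ (Fin p) => x i) 2 (multivariateGaussian 0 T) :=
    fun i => (EuclideanSpace.proj (𝕜 := ℝ) i).comp_memLp' IsGaussian.memLp_two_id
  have hmean : ∀ i, ∫ x : EuclideanSpace ℝ (Fin p), x i ∂(multivariateGaussian 0 T) = 0 :=
    fun i => by
      have h := (EuclideanSpace.proj (𝕜 := ℝ) i).integral_comp_comm
        (IsGaussian.integrable_id (μ := multivariateGaussian 0 T))
      simpa using h
  have hint := (hL j).integrable_mul (hL l)
  have hcov := covariance_eval_multivariateGaussian (μ := 0) hT j l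
  rw [covariance_eq_sub (hL j) (hL l), hmean, hmean, mul_zero, sub_zero] at hcov
  rw [← hY.map_eq] at hint hcov
  rw [integrable_map_measure hint.1 hY.aemeasurable] at hint
  refine ⟨hint, ?_⟩
  rw [integral_map hY.aemeasurable (by fun_prop)] at hcov
  exact hcov

theorem pow_le_one_add_pow {x : ℝ} (hx : 0 ≤ x) {a b : ℕ} (h : a ≤ b) : x ^ a ≤ 1 + x ^ b := by
  rcases le_total x 1 with h1 | h1
  · exact (pow_le_one₀ hx h1).trans (by linarith [pow_nonneg hx b])
  · exact (pow_le_pow_right₀ h1 h).trans (by linarith)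

theorem integral_pow_le_of_moment [IsProbabilityMeasure P] {f : Ω → ℝ} {M : ℝ} {a b : ℕ}
    (hf : Measurable f) (h : a ≤ b)
    (hM : Integrable (fun ω => |f ω| ^ b) P ∧ ∫ ω, |f ω| ^ b ∂P ≤ M) :
    Integrable (fun ω => |f ω| ^ a) P ∧ ∫ ω, |f ω| ^ a ∂P ≤ 1 + M := by
  have hint : Integrable (fun ω => 1 + |f ω| ^ b) P := (integrable_const _).add hM.1
  have hle : ∀ ω, |f ω| ^ a ≤ 1 + |f ω| ^ b := fun ω => pow_le_one_add_pow (abs_nonneg _) h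
  have hint' : Integrable (fun ω => |f ω| ^ a) P := by
    refine hint.mono' (by fun_prop) (.of_forall fun ω => ?_)
    rw [Real.norm_of_nonneg (by positivity)]
    exact hle ω
  refine ⟨hint', (integral_mono hint' hint hle).trans ?_⟩
  rw [integral_add (integrable_const _) hM.1]
  simpa using hM.2

/-- Under block dependence, each row of the second moment matrix has at most `d` nonzero
entries. -/
theorem sum_sq_le_of_isBlockDependent {d : ℕ} {Sig : Matrix (Fin p) (Fin p) ℝ} {C : ℝ}
    (hY : HasMoments Y n Sig P) (hd : IsBlockDependent Y d P)
    (hC : ∀ j l, |Sig j l / n| ≤ C) :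
    ∑ j, ∑ l, (Sig j l / n) ^ 2 ≤ p * (d * C ^ 2) := by
  obtain ⟨K, -, B, -, hcov, hcard, hind⟩ := hd
  refine (Finset.sum_le_card_nsmul _ _ (d * C ^ 2) fun j _ => ?_).trans (by simp)
  obtain ⟨a, ha⟩ := hcov j
  have hzero : ∀ l ∉ B a, (Sig j l / n) ^ 2 = 0 := by
    intro l hl
    obtain ⟨b, hb⟩ := hcov l
    have hab : a ≠ b := fun h => hl (h ▸ hb)
    -- Centred coordinates in different cells are uncorrelated.
    have h := (hind a b hab j ha l hb).integral_fun_mul_eq_mul_integral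
      (hY.1 j).1.1 (hY.1 l).1.1
    rw [(hY.2 j l).2, (hY.1 j).2, zero_mul] at h
    rw [h]; simp
  rw [← Finset.sum_subset (Finset.subset_univ (B a)) fun l _ hl => hzero l hl]
  refine (Finset.sum_le_card_nsmul _ _ (C ^ 2) fun l _ => ?_).trans ?_
  · exact sq_le_sq' (abs_le.1 (hC j l)).1 (abs_le.1 (hC j l)).2
  · rw [nsmul_eq_mul]
    have : ((B a).card : ℝ) ≤ d := by exact_mod_cast hcard a
    gcongr

end Moments

/-! ### Moment bounds in the proportional regime. -/

section Covariates

variable {Ω : Type*} [MeasurableSpace Ω] {P : Measure Ω} {n p d : ℕ}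
  {Sig : Matrix (Fin p) (Fin p) ℝ}

/-- Even moments of a normalised coordinate control those of the coordinate. -/
theorem integral_pow_le_of_scaled_moment [IsProbabilityMeasure P] {f : Ω → ℝ} {M : ℝ} {a b : ℕ}
    (hn : 0 < n) (hf : Measurable f) (h : 2 * a ≤ b)
    (hM : Integrable (fun ω => |√(n : ℝ) * f ω| ^ b) P ∧ ∫ ω, |√(n : ℝ) * f ω| ^ b ∂P ≤ M) :
    Integrable (fun ω => f ω ^ (2 * a)) P ∧ ∫ ω, f ω ^ (2 * a) ∂P ≤ (1 + M) / n ^ a := by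
  have hn' : (0 : ℝ) < n := by exact_mod_cast hn
  have heq : ∀ ω, |√(n : ℝ) * f ω| ^ (2 * a) = (n : ℝ) ^ a * f ω ^ (2 * a) := fun ω => by
    rw [Even.pow_abs (even_two_mul a), mul_pow, pow_mul, Real.sq_sqrt hn'.le]
  have h' := integral_pow_le_of_moment (hf.const_mul √(n : ℝ)) h hM
  simp only [heq] at h'
  rw [integrable_const_mul_iff (IsUnit.mk0 _ (by positivity)), integral_const_mul] at h'
  exact ⟨h'.1, by rw [le_div_iff₀' (by positivity)]; exact h'.2⟩

theorem HasMoments.abs_le {Y : Ω → EuclideanSpace ℝ (Fin p)} {C : ℝ} (hY : HasMoments Y n Sig P)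
    (hC : ∀ j, ∫ ω, Y ω j ^ 2 ∂P ≤ C) (j l : Fin p) : |Sig j l / n| ≤ C := by
  have hsq : ∀ j, Integrable (fun ω => Y ω j ^ 2) P := fun j => by
    simpa only [sq] using (hY.2 j j).1
  rw [← (hY.2 j l).2]
  calc |∫ ω, Y ω j * Y ω l ∂P| ≤ ∫ ω, |Y ω j * Y ω l| ∂P := abs_integral_le_integral_abs
    _ ≤ ∫ ω, (1 / 2 * Y ω j ^ 2 + 1 / 2 * Y ω l ^ 2) ∂P := by
        refine integral_mono (hY.2 j l).1.abs
          (((hsq j).const_mul _).add ((hsq l).const_mul _)) fun ω => ?_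
        change |Y ω j * Y ω l| ≤ 1 / 2 * Y ω j ^ 2 + 1 / 2 * Y ω l ^ 2
        rw [abs_mul, ← sq_abs (Y ω j), ← sq_abs (Y ω l)]
        nlinarith [sq_nonneg (|Y ω j| - |Y ω l|)]
    _ = 1 / 2 * ∫ ω, Y ω j ^ 2 ∂P + 1 / 2 * ∫ ω, Y ω l ^ 2 ∂P := by
        rw [integral_add ((hsq j).const_mul _) ((hsq l).const_mul _), integral_const_mul,
          integral_const_mul]
    _ ≤ C := by linarith [hC j, hC l]

/-- Allows the diagonal contribution, of order `n`, to be absorbed into `n d`. -/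
theorem IsBlockDependent.one_le {Y : Ω → EuclideanSpace ℝ (Fin p)} (hY : IsBlockDependent Y d P)
    (hp : 0 < p) : 1 ≤ d := by
  obtain ⟨K, -, B, -, hcov, hcard, -⟩ := hY
  obtain ⟨a, ha⟩ := hcov ⟨0, hp⟩
  exact (Finset.card_pos.2 ⟨_, ha⟩).trans_le (hcard a)

/-- The expected squared Frobenius norm of the Gram matrix is of order `n d` for proportional
dimensions. -/
theorem integral_gramSq_le_of_proportional {Z : Fin n → Ω → EuclideanSpace ℝ (Fin p)}
    {τ C C' : ℝ} (hn : 0 < n) (hτ : 0 < τ) (hp : (p : ℝ) / n ≤ 1 / τ) (hd : 1 ≤ d)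
    (hC' : 0 ≤ C') (hZ : ∀ i, Measurable (Z i)) (hind : iIndepFun Z P)
    (hmom : ∀ i j l, Integrable (fun ω => Z i ω j * Z i ω l) P ∧
      ∫ ω, Z i ω j * Z i ω l ∂P = Sig j l / n)
    (hSig : ∑ j, ∑ l, (Sig j l / n) ^ 2 ≤ p * (d * (C / n) ^ 2))
    (h4 : ∀ i j, Integrable (fun ω => Z i ω j ^ 4) P ∧ ∫ ω, Z i ω j ^ 4 ∂P ≤ C' / n ^ 2) :
    Integrable (fun ω => gramSq fun i => Z i ω) P ∧
      ∫ ω, gramSq (fun i => Z i ω) ∂P ≤ n * d * (C ^ 2 / τ + C' / τ ^ 2) := by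
  have hn' : (0 : ℝ) < n := by exact_mod_cast hn
  have hd' : (1 : ℝ) ≤ d := by exact_mod_cast hd
  have h := integral_gramSq_le (T := fun j l => Sig j l / n) hZ hind hmom h4
  refine ⟨h.1, h.2.trans ?_⟩
  have hr : (p : ℝ) / n ≤ τ⁻¹ := by rwa [← one_div]
  have hr0 : 0 ≤ (p : ℝ) / n := by positivity
  calc (n : ℝ) ^ 2 * ∑ j, ∑ l, (Sig j l / n) ^ 2 + n * ((p : ℝ) ^ 2 * (C' / n ^ 2))
      ≤ (n : ℝ) ^ 2 * (p * (d * (C / n) ^ 2)) + n * ((p : ℝ) ^ 2 * (C' / n ^ 2)) := by gcongr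
    _ = n * d * (C ^ 2 * (p / n)) + n * 1 * (C' * (p / n) ^ 2) := by field_simp
    _ ≤ n * d * (C ^ 2 * τ⁻¹) + n * d * (C' * τ⁻¹ ^ 2) := by gcongr
    _ = _ := by field_simp

end Covariates

/-! ### From the Gaussian gap to the estimator. -/

section Estimator

variable {Ω : Type*} [MeasurableSpace Ω] {P : Measure Ω} [IsProbabilityMeasure P] {n p : ℕ}

/-- If the Gaussian cost has a gap on `S`, then `S` avoids the neighbourhood of `-θ₀` in which
every minimizer under a well-conditioned design lies. -/
theorem measureReal_minimizer_mem_le {loss : ℝ → ℝ} {L₀ lam κ : ℝ}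
    {θ₀ : EuclideanSpace ℝ (Fin p)} {X G : Fin n → Ω → EuclideanSpace ℝ (Fin p)}
    {ξ : Fin n → Ω → ℝ} (hloss : ∀ a b, |loss a - loss b| ≤ L₀ * |a - b|) (hL : 0 ≤ L₀)
    (hlam : 0 < lam) (hκ : 0 ≤ κ) {ŵ : Ω → EuclideanSpace ℝ (Fin p)}
    (hŵ : ∀ᵐ ω ∂P, IsMinOn (robustCost loss lam θ₀ (fun i => X i ω) (fun i => ξ i ω)) Set.univ
      (ŵ ω))
    {S : Set (EuclideanSpace ℝ (Fin p))} {z ρ₀ εn b : ℝ} (hρκ : 5 * (L₀ * κ) ^ 2 ≤ lam * ρ₀)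
    (hεn : εn < 1 / 4)
    (h₁ : P.real {ω | ((z + ρ₀ : ℝ) : EReal) ≤
      minRobustCost loss lam θ₀ Set.univ (fun i => G i ω) (fun i => ξ i ω)} ≤ εn)
    (h₂ : P.real {ω | minRobustCost loss lam θ₀ S (fun i => G i ω) (fun i => ξ i ω) ≤
      ((z + 2 * ρ₀ : ℝ) : EReal)} ≤ εn)
    (hX : P.real {ω | (n * κ ^ 2) ^ 2 < gramSq fun i => X i ω} ≤ b)
    (hG : P.real {ω | (n * κ ^ 2) ^ 2 < gramSq fun i => G i ω} ≤ b) :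
    P.real {ω | ŵ ω ∈ S} ≤ 2 * b := by
  have hb : 0 ≤ b := measureReal_nonneg.trans hX
  -- For `b ≥ 1/2` the claim is trivial. Otherwise `2 εn + b < 1`, so the three bad Gaussian events
  -- cannot cover `Ω`.
  rcases le_or_gt (1 / 2) b with hb' | hb'
  · exact measureReal_le_one.trans (by linarith)
  have hgood : ∃ ω, gramSq (fun i => G i ω) ≤ (n * κ ^ 2) ^ 2 ∧
      minRobustCost loss lam θ₀ Set.univ (fun i => G i ω) (fun i => ξ i ω) <
        ((z + ρ₀ : ℝ) : EReal) ∧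
      ((z + 2 * ρ₀ : ℝ) : EReal) <
        minRobustCost loss lam θ₀ S (fun i => G i ω) (fun i => ξ i ω) := by
    by_contra! hcon
    have hcover : (Set.univ : Set Ω) ⊆
        ({ω | ((z + ρ₀ : ℝ) : EReal) ≤
          minRobustCost loss lam θ₀ Set.univ (fun i => G i ω) (fun i => ξ i ω)} ∪
        {ω | minRobustCost loss lam θ₀ S (fun i => G i ω) (fun i => ξ i ω) ≤
          ((z + 2 * ρ₀ : ℝ) : EReal)}) ∪ {ω | (n * κ ^ 2) ^ 2 < gramSq fun i => G i ω} := by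
      intro ω _
      by_cases ha : (n * κ ^ 2) ^ 2 < gramSq fun i => G i ω
      · exact Or.inr ha
      by_cases hc : ((z + ρ₀ : ℝ) : EReal) ≤
          minRobustCost loss lam θ₀ Set.univ (fun i => G i ω) (fun i => ξ i ω)
      · exact Or.inl (Or.inl hc)
      · exact Or.inl (Or.inr (hcon ω (not_lt.1 ha) (not_le.1 hc)))
    have h := (measureReal_mono hcover (measure_ne_top P _)).trans
      ((measureReal_union_le _ _).trans (add_le_add_left (measureReal_union_le _ _) _))
    rw [probReal_univ] at h
    linarith
  obtain ⟨ω₀, hQ, hmin, hgap⟩ := hgood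
  obtain ⟨v, hv⟩ := iInf_lt_iff.1 hmin
  obtain ⟨-, hv⟩ := iInf_lt_iff.1 hv
  rw [EReal.coe_lt_coe_iff] at hv
  -- A point of `S` in the ball would cost at most `ρ₀` more than `v`, hence less than `z + 2 * ρ₀`,
  -- against the gap. As neither `S` nor the ball is random, the single outcome `ω₀` decides.
  have havoid : ∀ w ∈ S, ¬ lam * ‖w + θ₀‖ ≤ 2 * (L₀ * κ) := by
    intro w hw hball
    have h3 := hgap.trans_le (iInf₂_le w hw)
    rw [EReal.coe_lt_coe_iff] at h3
    have h4 := (robustCost_sub_le (ξ := fun i => ξ i ω₀) hloss hL hlam hκ hQ hball v).trans hρκ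
    have h5 := le_of_mul_le_mul_left h4 hlam
    linarith
  refine (?_ : P.real {ω | ŵ ω ∈ S} ≤ b).trans (by linarith)
  refine le_trans ?_ hX
  refine ENNReal.toReal_mono (measure_ne_top P _) (measure_mono_ae ?_)
  filter_upwards [hŵ] with ω hω hmem
  by_contra hle
  exact havoid _ hmem (norm_add_le_of_robustCost_le hloss hL hκ (not_lt.1 hle)
    (hω (Set.mem_univ _)))

end Estimator

/-! ### The rate and the final assembly. -/

theorem div_natCast_le_rpow {n d : ℕ} {ε : ℝ} (hn : 1 ≤ n) (hε : 0 < ε)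
    (hd : (d : ℝ) ≤ (n : ℝ) ^ (1 / 4 - ε)) : (d : ℝ) / n ≤ (n : ℝ) ^ (-(1 / 45) : ℝ) := by
  have hn' : (1 : ℝ) ≤ n := by exact_mod_cast hn
  calc (d : ℝ) / n ≤ (n : ℝ) ^ (1 / 4 - ε) / n := by gcongr
    _ = (n : ℝ) ^ (1 / 4 - ε - 1) := by
        rw [Real.rpow_sub_one (by positivity)]
    _ ≤ _ := Real.rpow_le_rpow_of_exponent_le hn' (by linarith)

theorem theorem3 (lam τ M k ε L₀ : ℝ) (hlam : 0 < lam) (hτ₀ : 0 < τ) (hτ₁ : τ < 1)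
    (hL₀ : 0 < L₀) (hε₀ : 0 < ε) (hε₁ : ε ≤ 1 / 4) (hk : 3 / (2 * ε) < k) :
    -- the constant depends on `lam, τ, M, k, ε, L₀` only
    ∃ K : ℝ, 0 < K ∧
      ∀ d : ℕ → ℕ, (fun n => (d n : ℝ)) =o[atTop] (fun n : ℕ => (n : ℝ) ^ (1 / 4 - ε)) →
      ∀ᶠ n : ℕ in atTop, ∀ p : ℕ, τ ≤ (p : ℝ) / n → (p : ℝ) / n ≤ 1 / τ →
      -- loss, true parameter, covariance matrix
      ∀ (loss : ℝ → ℝ), IsRobustLoss loss L₀ →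
      ∀ (θ₀ : EuclideanSpace ℝ (Fin p)) (Sig : Matrix (Fin p) (Fin p) ℝ), Sig.PosDef →
      ∀ (Ω : Type*) [MeasurableSpace Ω] (P : Measure Ω) [IsProbabilityMeasure P]
        (X G : Fin n → Ω → EuclideanSpace ℝ (Fin p)) (ξ : Fin n → Ω → ℝ),
      -- covariates
      IsIID X P → (∀ i, HasMoments (X i) n Sig P) → (∀ i, IsBlockDependent (X i) (d n) P) →
      (∀ i j, Integrable (fun ω => |√(n : ℝ) * X i ω j| ^ (2 * ⌈k / 2⌉₊)) P ∧
        ∫ ω, |√(n : ℝ) * X i ω j| ^ (2 * ⌈k / 2⌉₊) ∂P ≤ M) →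
      -- Gaussian covariates
      IsIID G P → (∀ i, HasLaw (G i) (multivariateGaussian 0 ((n : ℝ)⁻¹ • Sig)) P) →
      -- noise, independent of the covariates
      IsIID ξ P → IndepFun (fun ω i => X i ω) (fun ω i => ξ i ω) P →
      IndepFun (fun ω i => G i ω) (fun ω i => ξ i ω) P →
      -- the estimator: the minimizer of the cost under the covariates `X`
      ∀ ŵ : Ω → EuclideanSpace ℝ (Fin p),
      (∀ᵐ ω ∂P, IsMinOn (robustCost loss lam θ₀ (fun i => X i ω) (fun i => ξ i ω)) Set.univ
        (ŵ ω)) →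
      -- the exceptional set and the gap condition for the Gaussian cost
      ∀ S : Set (EuclideanSpace ℝ (Fin p)), MeasurableSet S →
      ∀ z ρ₀ εn : ℝ, 0 < ρ₀ → 0 ≤ εn → εn < 1 / 4 →
      max
        (P.real {ω | ((z + ρ₀ : ℝ) : EReal) ≤
          minRobustCost loss lam θ₀ Set.univ (fun i => G i ω) (fun i => ξ i ω)})
        (P.real {ω | minRobustCost loss lam θ₀ S (fun i => G i ω) (fun i => ξ i ω) ≤
          ((z + 2 * ρ₀ : ℝ) : EReal)}) ≤ εn →
      P.real {ω | ŵ ω ∈ S} ≤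
        4 * εn + K * (1 + ‖WithLp.ofLp θ₀‖ ^ k + ρ₀ ^ (-3 : ℤ)) * (n : ℝ) ^ (-(1 / 45) : ℝ) := by
  set C : ℝ := 1 + |M| with hC
  -- A common fourth-moment constant: the first summand serves `X`, the second `G`.
  set C' : ℝ := C + gaussianFourthMoment * C ^ 2 with hC'
  set A : ℝ := C ^ 2 / τ + C' / τ ^ 2 with hA
  have hC0 : 0 < C := by positivity
  have hC'0 : 0 < C' :=
    add_pos_of_pos_of_nonneg hC0 (mul_nonneg gaussianFourthMoment_nonneg (by positivity))
  have hA0 : 0 < A := by positivity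
  -- `50 = 2 * 25`: the factor `2` of `measureReal_minimizer_mem_le`, and `κ⁴ = lam² ρ₀² / (25 L₀⁴)`
  -- in Markov's denominator.
  refine ⟨50 * A * L₀ ^ 4 / lam ^ 2, by positivity, fun d hd => ?_⟩
  have hd1 := hd.bound one_pos
  filter_upwards [hd1, eventually_ge_atTop 1] with n hdn hn p hp₁ hp₂ loss hloss θ₀ Sig hSig Ω _ P _
    X G ξ hX hXmom hXblock hXM hG hGlaw _ _ _ ŵ hŵ S _ z ρ₀ εn hρ₀ hεn₀ hεn hgap
  have hn' : (0 : ℝ) < n := by exact_mod_cast hn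
  have hp : 0 < p := by
    rcases Nat.eq_zero_or_pos p with rfl | h
    · simp at hp₁; linarith
    · exact h
  have hk4 : 2 * 2 ≤ 2 * ⌈k / 2⌉₊ := by
    have hk6 : 2 < k := by
      refine lt_of_lt_of_le ?_ hk.le
      rw [lt_div_iff₀ (by positivity)]
      linarith
    have : 1 < ⌈k / 2⌉₊ := Nat.lt_ceil.2 (by push_cast; linarith)
    omega
  let i₀ : Fin n := ⟨0, hn⟩
  have hd₁ : 1 ≤ d n := (hXblock i₀).one_le hp
  have hXcoord : ∀ i j, Measurable fun ω => X i ω j := fun i j =>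
    (by fun_prop : Measurable fun x : EuclideanSpace ℝ (Fin p) => x j).comp (hX.1 i)
  have hMC : 1 + M ≤ C := by rw [hC]; linarith [le_abs_self M]
  have hX2 : ∀ j, ∫ ω, X i₀ ω j ^ 2 ∂P ≤ C / n := fun j => by
    have h := (integral_pow_le_of_scaled_moment (a := 1) hn (hXcoord i₀ j) (by omega)
      (hXM i₀ j)).2
    rw [mul_one, pow_one] at h
    exact h.trans (by gcongr)
  have hSigC := (hXmom i₀).abs_le hX2
  have hX4 : ∀ i j, Integrable (fun ω => X i ω j ^ 4) P ∧ ∫ ω, X i ω j ^ 4 ∂P ≤ C' / n ^ 2 :=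
    fun i j => by
      have h := integral_pow_le_of_scaled_moment (a := 2) hn (hXcoord i j) hk4 (hXM i j)
      have hCC' : 1 + M ≤ C' := hMC.trans
        (le_add_of_nonneg_right (mul_nonneg gaussianFourthMoment_nonneg (by positivity)))
      exact ⟨h.1, h.2.trans (by gcongr)⟩
  have hT : ((n : ℝ)⁻¹ • Sig).PosSemidef := hSig.posSemidef.smul (by positivity)
  have hTe : ∀ j l, ((n : ℝ)⁻¹ • Sig) j l = Sig j l / n := fun j l => by
    rw [Matrix.smul_apply, smul_eq_mul, inv_mul_eq_div]
  have hGmom : ∀ i j l, Integrable (fun ω => G i ω j * G i ω l) P ∧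
      ∫ ω, G i ω j * G i ω l ∂P = Sig j l / n := fun i j l => by
    rw [← hTe]; exact integral_mul_of_hasLaw_multivariateGaussian hT (hGlaw i) j l
  have hG4 : ∀ i j, Integrable (fun ω => G i ω j ^ 4) P ∧ ∫ ω, G i ω j ^ 4 ∂P ≤ C' / n ^ 2 :=
    fun i j => by
      have h := integral_pow_four_of_hasLaw_multivariateGaussian hT (hGlaw i) j
      refine ⟨h.1, h.2.le.trans ?_⟩
      rw [hTe]
      have hsq : (Sig j j / n) ^ 2 ≤ (C / n) ^ 2 :=
        sq_le_sq' (abs_le.1 (hSigC j j)).1 (abs_le.1 (hSigC j j)).2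
      calc gaussianFourthMoment * (Sig j j / n) ^ 2 ≤ gaussianFourthMoment * (C / n) ^ 2 :=
            mul_le_mul_of_nonneg_left hsq gaussianFourthMoment_nonneg
        _ = gaussianFourthMoment * C ^ 2 / n ^ 2 := by ring
        _ ≤ C' / n ^ 2 := by gcongr; rw [hC']; linarith
  -- The sparsity of `Sig` comes from `X`, but it serves `G` as well because the covariance is
  -- shared.
  have hSigsum := sum_sq_le_of_isBlockDependent (hXmom i₀) (hXblock i₀) hSigC
  have hEX := integral_gramSq_le_of_proportional hn hτ₀ hp₂ hd₁ hC'0.le hX.1 hX.2.1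
    (fun i => (hXmom i).2) hSigsum hX4
  have hEG := integral_gramSq_le_of_proportional hn hτ₀ hp₂ hd₁ hC'0.le hG.1 hG.2.1
    hGmom hSigsum hG4
  -- The largest `κ` allowed by `5 (L₀ κ)² ≤ lam ρ₀`.
  set κ : ℝ := √(lam * ρ₀ / (5 * L₀ ^ 2)) with hκ
  have hκ2 : κ ^ 2 = lam * ρ₀ / (5 * L₀ ^ 2) := Real.sq_sqrt (by positivity)
  have ht : 0 < (n * κ ^ 2) ^ 2 := by rw [hκ2]; positivity
  have hρκ : 5 * (L₀ * κ) ^ 2 ≤ lam * ρ₀ := by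
    rw [mul_pow, hκ2]; exact le_of_eq (by field_simp)
  have hmain := measureReal_minimizer_mem_le hloss.abs_sub_le hL₀.le hlam (Real.sqrt_nonneg _) hŵ
    hρκ hεn ((le_max_left _ _).trans hgap) ((le_max_right _ _).trans hgap)
    (measureReal_gramSq_lt_le ht hEX) (measureReal_gramSq_lt_le ht hEG)
  have hdn' : (d n : ℝ) ≤ (n : ℝ) ^ (1 / 4 - ε) := by
    rw [one_mul, Real.norm_of_nonneg (by positivity), Real.norm_of_nonneg (by positivity)] at hdn
    exact hdn
  have hρ : (ρ₀⁻¹) ^ 2 ≤ 1 + ‖WithLp.ofLp θ₀‖ ^ k + ρ₀ ^ (-3 : ℤ) := by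
    have h := pow_le_one_add_pow (inv_nonneg.2 hρ₀.le) (by norm_num : 2 ≤ 3)
    have h' : ρ₀ ^ (-3 : ℤ) = ρ₀⁻¹ ^ 3 := by rw [inv_pow]; rfl
    rw [h']
    linarith [Real.rpow_nonneg (norm_nonneg (WithLp.ofLp θ₀)) k]
  refine hmain.trans ?_
  calc 2 * (n * d n * A / (n * κ ^ 2) ^ 2)
      = 50 * A * L₀ ^ 4 / lam ^ 2 * ρ₀⁻¹ ^ 2 * (d n / n) := by rw [hκ2]; field_simp; ring
    _ ≤ 50 * A * L₀ ^ 4 / lam ^ 2 * (1 + ‖WithLp.ofLp θ₀‖ ^ k + ρ₀ ^ (-3 : ℤ)) *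
        (n : ℝ) ^ (-(1 / 45) : ℝ) := by
        gcongr
        exact div_natCast_le_rpow hn hε₀ hdn'
    _ ≤ _ := by linarith
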